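/- **Definitions.** A \emph{distribution instance} $G=(\mathcal I^{(0)},\mathcal I^{(1)};\mathcal F;w)$ is a finite bipartite graph with vertex sides $\mathcal I^{(0)},\mathcal I^{(1)}$, edge set $\mathcal F\subseteq\mathcal I^{(0)}\times\mathcal I^{(1)}$, no isolated vertices, and positive vertex weights $w$ that sum to $1$ on each side. A \emph{distribution refinement pair} is a pair $(\alpha^{(0)},\alpha^{(1)})$ of probability distributions on $\mathcal F$ such that for each $\iota\in\{0,1\}$ and each $i\in\mathcal I^{(\iota)}$ we have $\sum_{f\in\mathcal F:\, i\in f}\alpha^{(\iota)}(f)=w(i)$. A \emph{divergence} $\mathsf D$ assigns to any two probability distributions $P,Q$ on the same finite sample space a value $\mathsf D(P\|Q)\in[-\infty,\infty]$; it satisfies the \emph{data processing inequality} if $\mathsf D(\varphi(P)\|\varphi(Q))\le\mathsf D(P\|Q)$ for all finite $\Omega,\widehat\Omega$, all distributions $P,Q$ on $\Omega$ and every post-processing $\varphi$ from $\Omega$ to $\widehat\Omega$, deterministic or randomized (that is, every Markov kernel). A refinement pair of $G$ is \emph{universally closest} if, for every divergence $\mathsf D$ satisfying the data processing inequality, it minimizes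 $\mathsf D(\alpha^{(0)}\|\alpha^{(1)})$ among all distribution refinement pairs of $G$. The \emph{minimum quadratic-cost flow problem} asks, for a directed graph with edge capacities $u_e\ge 0$, cost coefficients $a_e\ge 0$ and vertex demands $d_v$ for which a feasible flow exists, for a feasible flow (that is, $0\le f_e\le u_e$, and the net inflow at each vertex $v$ is $d_v$) minimizing $\sum_e a_e f_e^2$. The size of such a network is its number of vertices plus its number of edges. Running times are counted in steps of a real RAM with exact real arithmetic. **Theorem (Universally Closest Refinement Pair).** 1. Every distribution instance has a universally closest refinement pair. 2. Such a pair can be returned using any algorithm for the minimum quadratic-cost flow problem (such as the near-linear time algorithm of Chen et al.). Precisely, there are a real-RAM program and a constant $C$ such that on every distribution instance with $m$ edges, given by its vertex weights and its edges listed in any order, the program performs at most $Cm$ steps and exactly one call of the flow algorithm, on a feasible network of size at most $Cm$; and if the answer to this call is an optimal flow, the program returns a universally closest refinement pair. Consequently, if the flow algorithm takes time at most $T(s)$ on networks of size $s$, where $T(s)=s^{1+o(1)}$, then the total running time is $m^{1+o(1)}$. -/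

import Mathlib

universe u

namespace ClosestRefinement

/-- Probability distributions on a finite sample space. -/
abbrev FinDist (Ω : Type u) [Fintype Ω] : Type u := stdSimplex ℝ Ω

/-- The distribution obtained from `P` by (possibly randomized) post-processing: a sample `x` of `P`
is replaced by a sample of the distribution `κ x`. -/
def FinDist.process {Ω Ω' : Type u} [Fintype Ω] [Fintype Ω'] (P : FinDist Ω)
    (κ : Ω → FinDist Ω') : FinDist Ω' :=
  ⟨fun y => ∑ x, P.1 x * (κ x).1 y,
    fun y => Finset.sum_nonneg fun x _ => mul_nonneg (P.2.1 x) ((κ x).2.1 y), by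
      rw [Finset.sum_comm]
      simp_rw [← Finset.mul_sum, (κ _).2.2, mul_one]
      exact P.2.2⟩

/-- A divergence notion: a value `D Ω P Q` for all distributions `P`, `Q` on the same finite sample
space. The value may be infinite, as for the Kullback–Leibler divergence; no symmetry, continuity
or normalization is required. -/
def Divergence : Type (u + 1) :=
  ∀ (Ω : Type u) [Fintype Ω], FinDist Ω → FinDist Ω → EReal

/-- The data processing inequality: post-processing does not increase the divergence. -/
def Divergence.DataProcessing (D : Divergence.{u}) : Prop :=
  ∀ (Ω Ω' : Type u) [Fintype Ω] [Fintype Ω'] (κ : Ω → FinDist Ω') (P Q : FinDist Ω),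
    D Ω' (P.process κ) (Q.process κ) ≤ D Ω P Q

/-- A distribution instance: a finite bipartite graph with positive vertex weights that sum to one
on each side. -/
structure DistInstance (I₀ I₁ : Type u) [Fintype I₀] [Fintype I₁] where
  edges : Finset (I₀ × I₁)
  w₀ : I₀ → ℝ
  w₁ : I₁ → ℝ
  w₀_pos : ∀ i, 0 < w₀ i
  w₁_pos : ∀ j, 0 < w₁ j
  sum_w₀ : ∑ i, w₀ i = 1
  sum_w₁ : ∑ j, w₁ j = 1

namespace DistInstance

variable {I₀ I₁ : Type u} [Fintype I₀] [Fintype I₁] (G : DistInstance I₀ I₁)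

/-- Every vertex has a neighbour. -/
def NoIsolated : Prop :=
  (∀ i, ∃ j, (i, j) ∈ G.edges) ∧ (∀ j, ∃ i, (i, j) ∈ G.edges)

open scoped Classical in
/-- Each non-isolated vertex of side `0` distributes its weight among its incident edges. -/
def IsRefinement₀ (α : FinDist G.edges) : Prop :=
  ∀ i, (∃ j, (i, j) ∈ G.edges) → ∑ f : G.edges with f.1.1 = i, α.1 f = G.w₀ i

open scoped Classical in
/-- Each non-isolated vertex of side `1` distributes its weight among its incident edges. -/
def IsRefinement₁ (α : FinDist G.edges) : Prop :=
  ∀ j, (∃ i, (i, j) ∈ G.edges) → ∑ f : G.edges with f.1.2 = j, α.1 f = G.w₁ j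

/-- A distribution refinement pair: two distributions on the edges that refine the vertex weights of
side `0` and of side `1`, respectively. -/
def IsRefinementPair (α₀ α₁ : FinDist G.edges) : Prop :=
  G.IsRefinement₀ α₀ ∧ G.IsRefinement₁ α₁

/-- A distribution refinement pair that is closest with respect to all divergences satisfying the
data processing inequality. -/
def IsUniversallyClosest (α₀ α₁ : FinDist G.edges) : Prop :=
  G.IsRefinementPair α₀ α₁ ∧
    ∀ D : Divergence.{u}, D.DataProcessing →
      ∀ β₀ β₁ : FinDist G.edges, G.IsRefinementPair β₀ β₁ → D G.edges α₀ α₁ ≤ D G.edges β₀ β₁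

end DistInstance

/-- The data of a minimum quadratic-cost flow problem on a directed (multi)graph with vertices
`0, …, numV - 1`: capacities and cost coefficients of the edges, and demands of the vertices. -/
structure FlowNetwork where
  numV : ℕ
  numE : ℕ
  tail : Fin numE → ℕ
  head : Fin numE → ℕ
  demand : Fin numV → ℝ
  cap : Fin numE → ℝ
  quad : Fin numE → ℝ

namespace FlowNetwork

variable (N : FlowNetwork)

/-- The number of vertices and edges. -/
def size : ℕ := N.numV + N.numE

/-- Feasible flows: capacities are respected and the net inflow of each vertex is its demand. -/
def IsFlow (f : Fin N.numE → ℝ) : Prop :=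
  (∀ e, 0 ≤ f e ∧ f e ≤ N.cap e) ∧
    ∀ v : Fin N.numV, (∑ e with N.head e = v, f e) - ∑ e with N.tail e = v, f e = N.demand v

/-- The cost `∑ aₑ fₑ²` of a flow. -/
def cost (f : Fin N.numE → ℝ) : ℝ := ∑ e, N.quad e * f e ^ 2

/-- Minimum-cost flows. -/
def IsOptimal (f : Fin N.numE → ℝ) : Prop :=
  N.IsFlow f ∧ ∀ g, N.IsFlow g → N.cost f ≤ N.cost g

/-- A legitimate instance of the problem: the edges join vertices of the network, the capacities and
cost coefficients are nonnegative, and there is a feasible flow. -/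
def IsProper : Prop :=
  (∀ e, N.tail e < N.numV ∧ N.head e < N.numV) ∧ (∀ e, 0 ≤ N.cap e) ∧ (∀ e, 0 ≤ N.quad e) ∧
    ∃ f, N.IsFlow f

end FlowNetwork

/-- A flow solver returns some edge vector for every network. Whether it is an optimal flow is stated
separately. -/
abbrev FlowSolver : Type := (N : FlowNetwork) → Fin N.numE → ℝ

/-- The memory of a real RAM: registers and arrays of natural numbers (for indices) and registers and
arrays of real numbers, which are exact. -/
structure Memory where
  ireg : ℕ → ℕ
  rreg : ℕ → ℝ
  iarr : ℕ → ℕ → ℕ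
  rarr : ℕ → ℕ → ℝ

/-- Arithmetic operations on reals. -/
inductive RealOp where
  | add
  | sub
  | mul
  | div

/-- The value of an arithmetic operation. -/
noncomputable def RealOp.eval : RealOp → ℝ → ℝ → ℝ
  | add, a, b => a + b
  | sub, a, b => a - b
  | mul, a, b => a * b
  | div, a, b => a / b

/-- Programs of a real RAM that may call a flow solver. -/
inductive Program where
  /-- index register `x := c` -/
  | iconst (x c : ℕ)
  /-- index registers `x := y + z` -/
  | iadd (x y z : ℕ)
  /-- index register `x := a[i]` for the index array `a` and the index register `i` -/
  | iload (x a i : ℕ)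
  /-- `a[i] := x` for the index array `a` and the index registers `i`, `x` -/
  | istore (a i x : ℕ)
  /-- real register `x := c` -/
  | rconst (x c : ℕ)
  /-- real registers `x := y o z` -/
  | rop (o : RealOp) (x y z : ℕ)
  /-- real register `x := a[i]` for the real array `a` and the index register `i` -/
  | rload (x a i : ℕ)
  /-- `a[i] := x` for the real array `a`, the index register `i` and the real register `x` -/
  | rstore (a i x : ℕ)
  /-- sequential composition -/
  | seq (p q : Program)
  /-- `for x := 0, …, n - 1 do p`, where `n` is the content of the index register `b` at the start -/
  | loop (x b : ℕ) (p : Program)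
  /-- call the flow solver -/
  | solve

/-- The network that a call of the solver refers to: the numbers of vertices and edges are in the
index registers `0`, `1`, the tails and heads in the index arrays `0`, `1`, and the demands,
capacities and cost coefficients in the real arrays `0`, `1`, `2`. -/
def Memory.network (s : Memory) : FlowNetwork where
  numV := s.ireg 0
  numE := s.ireg 1
  tail e := s.iarr 0 e
  head e := s.iarr 1 e
  demand v := s.rarr 0 v
  cap e := s.rarr 1 e
  quad e := s.rarr 2 e

/-- A state of a computation: the memory, the number of steps so far (not counting the work of the
solver), and the networks for which the solver was called so far. -/
structure Run where
  mem : Memory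
  steps : ℕ
  queries : List FlowNetwork

/-- Continue with the memory `s`, at the cost of one step. -/
def Run.step (r : Run) (s : Memory) : Run := ⟨s, r.steps + 1, r.queries⟩

open Function in
/-- Execution of a program. Each elementary instruction, each loop and each iteration of a loop costs
one step. The solver's answer is stored in the real array `3`. -/
noncomputable def Program.exec (S : FlowSolver) : Program → Run → Run
  | iconst x c, r => r.step { r.mem with ireg := update r.mem.ireg x c }
  | iadd x y z, r =>
      r.step { r.mem with ireg := update r.mem.ireg x (r.mem.ireg y + r.mem.ireg z) }
  | iload x a i, r =>
      r.step { r.mem with ireg := update r.mem.ireg x (r.mem.iarr a (r.mem.ireg i)) }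
  | istore a i x, r =>
      r.step { r.mem with
        iarr := update r.mem.iarr a (update (r.mem.iarr a) (r.mem.ireg i) (r.mem.ireg x)) }
  | rconst x c, r => r.step { r.mem with rreg := update r.mem.rreg x c }
  | rop o x y z, r =>
      r.step { r.mem with rreg := update r.mem.rreg x (o.eval (r.mem.rreg y) (r.mem.rreg z)) }
  | rload x a i, r =>
      r.step { r.mem with rreg := update r.mem.rreg x (r.mem.rarr a (r.mem.ireg i)) }
  | rstore a i x, r =>
      r.step { r.mem with
        rarr := update r.mem.rarr a (update (r.mem.rarr a) (r.mem.ireg i) (r.mem.rreg x)) }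
  | seq p q, r => q.exec S (p.exec S r)
  | loop x b p, r =>
      (List.range (r.mem.ireg b)).foldl
        (fun r k => p.exec S (r.step { r.mem with ireg := update r.mem.ireg x k }))
        (r.step r.mem)
  | solve, r =>
      ⟨{ r.mem with
          rarr := update r.mem.rarr 3 fun k =>
            if h : k < r.mem.network.numE then S r.mem.network ⟨k, h⟩ else r.mem.rarr 3 k },
        r.steps + 1, r.queries ++ [r.mem.network]⟩

/-- The input memory for a distribution instance whose edges are listed in the order `e`: the numbers
of vertices of side `0`, vertices of side `1` and edges are in the index registers `2`, `3`, `4`, the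
end points of the edges in the index arrays `2`, `3`, the weights of the two sides in the real arrays
`4`, `5`, and all other cells are zero. -/
def DistInstance.encode {n₀ n₁ m : ℕ} (G : DistInstance (Fin n₀) (Fin n₁))
    (e : Fin m ≃ G.edges) : Memory where
  ireg
    | 2 => n₀
    | 3 => n₁
    | 4 => m
    | _ => 0
  rreg _ := 0
  iarr
    | 2 => fun k => if h : k < m then ((e ⟨k, h⟩).1.1 : ℕ) else 0
    | 3 => fun k => if h : k < m then ((e ⟨k, h⟩).1.2 : ℕ) else 0
    | _ => fun _ => 0
  rarr
    | 4 => fun k => if h : k < n₀ then G.w₀ ⟨k, h⟩ else 0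
    | 5 => fun k => if h : k < n₁ then G.w₁ ⟨k, h⟩ else 0
    | _ => fun _ => 0

/-- The run of a program on a distribution instance. -/
noncomputable def Program.run (p : Program) (S : FlowSolver) {n₀ n₁ m : ℕ}
    (G : DistInstance (Fin n₀) (Fin n₁)) (e : Fin m ≃ G.edges) : Run :=
  p.exec S ⟨G.encode e, 0, []⟩

/-- The run ends with the pair `(α₀, α₁)` in the real arrays `6`, `7`, edge by edge. -/
def Run.Returns (r : Run) {n₀ n₁ m : ℕ} {G : DistInstance (Fin n₀) (Fin n₁)}
    (e : Fin m ≃ G.edges) (α₀ α₁ : FinDist G.edges) : Prop :=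
  ∀ k : Fin m, r.mem.rarr 6 k = α₀.1 (e k) ∧ r.mem.rarr 7 k = α₁.1 (e k)

/-- The total running time if the solver takes time `T s` on a network of size `s`. -/
def Run.time (r : Run) (T : ℕ → ℕ) : ℕ := r.steps + (r.queries.map fun N => T N.size).sum

/-- Near-linear growth, `T n = n ^ (1 + o(1))`. -/
def NearLinear (T : ℕ → ℕ) : Prop :=
  ∀ ε : ℝ, 0 < ε → (fun n => (T n : ℝ)) =O[Filter.atTop] fun n : ℕ => (n : ℝ) ^ (1 + ε)

end ClosestRefinement

open ClosestRefinement

/-! Let side `0` spread its weight so that the loads on side `1` minimize `∑ load² / w₁`, and let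
side `1` split its weight in the same proportions. Call `load / w₁` the density of a right vertex.
The first-order condition says that each left vertex sends weight only to neighbours of least
density (`IsBalanced.density_eq`), and the likelihood ratio `α₀ / α₁` of an edge is the density of
its right end. Every other refinement pair can be mapped onto this one by a single Markov kernel, so
data processing gives universal closeness. By separation of convex sets (`exists_process_eq`), such
a kernel exists if every linear functional of the target pair is dominated by a deterministic
post-processing of the source pair. A suitable one reads only the left end of an edge and uses the
least density among its neighbours (`IsBalanced.exists_isUniversallyClosest`). The objective is the
cost of a flow from side `0` through side `1` to a sink, so one call of the solver finds `α₀` and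
the loads (`isBalanced_of_isOptimal`). The rest is a verified linear-time program around that call
(`closestPair_run`). -/

namespace ClosestRefinement

open Finset

/-! ### A separation criterion for post-processing -/

/-- If every pair of linear functionals is dominated by a deterministic post-processing of `P`, `Q`,
then some randomized post-processing maps `P`, `Q` to `P'`, `Q'`. -/
theorem exists_process_eq {Ω Ω' : Type u} [Fintype Ω] [Fintype Ω'] (P Q : FinDist Ω)
    (P' Q' : FinDist Ω')
    (h : ∀ u v : Ω' → ℝ, ∃ y : Ω → Ω',
      ∑ z, (u z * P'.1 z + v z * Q'.1 z) ≤ ∑ x, (u (y x) * P.1 x + v (y x) * Q.1 x)) :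
    ∃ κ : Ω → FinDist Ω', P.process κ = P' ∧ Q.process κ = Q' := by
  classical
  let L : (Ω → Ω' → ℝ) →ₗ[ℝ] (Ω' → ℝ) × (Ω' → ℝ) :=
    { toFun := fun κ => (fun y => ∑ x, P.1 x * κ x y, fun y => ∑ x, Q.1 x * κ x y)
      map_add' := fun a b => by
        ext y <;> simp [mul_add, sum_add_distrib]
      map_smul' := fun c a => by
        ext y <;> simp [mul_sum, mul_left_comm] }
  let K : Set (Ω → Ω' → ℝ) := Set.pi Set.univ fun _ => stdSimplex ℝ Ω'
  have hK : IsCompact K := isCompact_univ_pi fun _ => isCompact_stdSimplex ℝ Ω'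
  have hKc : Convex ℝ K := convex_pi fun _ _ => convex_stdSimplex ℝ Ω'
  have hLK : IsCompact (L '' K) := hK.image L.continuous_of_finiteDimensional
  by_cases hmem : ((P'.1, Q'.1) : (Ω' → ℝ) × (Ω' → ℝ)) ∈ L '' K
  · obtain ⟨κ, hκ, e⟩ := hmem
    refine ⟨fun x => ⟨κ x, hκ x trivial⟩, ?_, ?_⟩
    · exact Subtype.ext (congrArg Prod.fst e)
    · exact Subtype.ext (congrArg Prod.snd e)
  -- The attainable pairs form a compact convex set, so an unattainable pair is strictly separated
  -- from it; `u`, `v` are the coordinates of the separating functional.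
  · exfalso
    obtain ⟨g, c, hg₁, hg₂⟩ :=
      geometric_hahn_banach_closed_point (hKc.linear_image L) hLK.isClosed hmem
    let u : Ω' → ℝ := fun z => g (Pi.single z 1, 0)
    let v : Ω' → ℝ := fun z => g (0, Pi.single z 1)
    have hg : ∀ a b : Ω' → ℝ, g (a, b) = ∑ z, (u z * a z + v z * b z) := by
      intro a b
      have hab : ((a, b) : (Ω' → ℝ) × (Ω' → ℝ)) =
          ∑ z, (a z • (Pi.single z 1, 0) + b z • (0, Pi.single z 1)) := by
        ext z <;> simp [Prod.fst_sum, Prod.snd_sum, Finset.sum_apply, Pi.single_apply]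
      rw [hab, map_sum]
      refine sum_congr rfl fun z _ => ?_
      rw [map_add, map_smul, map_smul]
      simp [u, v, mul_comm]
    obtain ⟨y, hy⟩ := h u v
    -- A deterministic map is the kernel of point masses, so its value obeys the separation bound,
    -- against `hy`.
    have hyK : (fun x => Pi.single (y x) 1 : Ω → Ω' → ℝ) ∈ K :=
      fun x _ => single_mem_stdSimplex ℝ (y x)
    have h₁ := hg₁ _ ⟨_, hyK, rfl⟩
    have h₂ : g (L fun x => Pi.single (y x) 1) = ∑ x, (u (y x) * P.1 x + v (y x) * Q.1 x) := by
      change g (fun z => ∑ x, P.1 x * (Pi.single (y x) 1 : Ω' → ℝ) z,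
        fun z => ∑ x, Q.1 x * (Pi.single (y x) 1 : Ω' → ℝ) z) = _
      rw [hg]
      simp_rw [mul_sum, ← sum_add_distrib]
      rw [sum_comm]
      refine sum_congr rfl fun x _ => ?_
      simp [Pi.single_apply, sum_add_distrib]
    rw [h₂] at h₁
    rw [hg] at hg₂
    exact absurd hy (by simpa using h₁.trans hg₂)

/-! ### Balanced refinements and universal closeness -/

namespace DistInstance

variable {I₀ I₁ : Type u} [Fintype I₀] [Fintype I₁] (G : DistInstance I₀ I₁)

open scoped Classical in
/-- The total amount that a vertex of side `0` sends on its edges. -/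
noncomputable def supply (x : G.edges → ℝ) (i : I₀) : ℝ := ∑ f : G.edges with f.1.1 = i, x f

open scoped Classical in
/-- The total amount that a vertex of side `1` receives on its edges. -/
noncomputable def load (x : G.edges → ℝ) (j : I₁) : ℝ := ∑ f : G.edges with f.1.2 = j, x f

/-- The amount received by a vertex of side `1`, relative to its weight. -/
noncomputable def density (x : G.edges → ℝ) (j : I₁) : ℝ := G.load x j / G.w₁ j

/-- The refinements of side `0` whose loads on side `1` have the least weighted sum of squares. -/
def IsBalanced (α : FinDist G.edges) : Prop :=
  G.IsRefinement₀ α ∧ ∀ β : FinDist G.edges, G.IsRefinement₀ β →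
    ∑ j, G.load α.1 j ^ 2 / G.w₁ j ≤ ∑ j, G.load β.1 j ^ 2 / G.w₁ j

theorem sum_mul_fst (x : G.edges → ℝ) (a : I₀ → ℝ) :
    ∑ f : G.edges, a f.1.1 * x f = ∑ i, a i * G.supply x i := by
  classical
  rw [← sum_fiberwise univ (fun f : G.edges => f.1.1)]
  refine sum_congr rfl fun i _ => ?_
  rw [supply, mul_sum]
  exact sum_congr (by congr) fun f hf => by rw [(mem_filter.1 hf).2]

theorem sum_mul_snd (x : G.edges → ℝ) (b : I₁ → ℝ) :
    ∑ f : G.edges, b f.1.2 * x f = ∑ j, b j * G.load x j := by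
  classical
  rw [← sum_fiberwise univ (fun f : G.edges => f.1.2)]
  refine sum_congr rfl fun i _ => ?_
  rw [load, mul_sum]
  exact sum_congr (by congr) fun f hf => by rw [(mem_filter.1 hf).2]

variable {G}

/-- Used to exchange one refinement for another: sums of functions of the left end alone do not see
which refinement is taken. -/
theorem IsRefinement₀.sum_mul (hG : G.NoIsolated) {α : FinDist G.edges} (hα : G.IsRefinement₀ α)
    (a : I₀ → ℝ) : ∑ f : G.edges, a f.1.1 * α.1 f = ∑ i, a i * G.w₀ i := by
  rw [sum_mul_fst]
  exact sum_congr rfl fun i _ => by rw [supply, hα i (hG.1 i)]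

theorem IsRefinement₁.sum_mul (hG : G.NoIsolated) {α : FinDist G.edges} (hα : G.IsRefinement₁ α)
    (b : I₁ → ℝ) : ∑ f : G.edges, b f.1.2 * α.1 f = ∑ j, b j * G.w₁ j := by
  rw [sum_mul_snd]
  exact sum_congr rfl fun j _ => by rw [load, hα j (hG.2 j)]

/-- The refinement of side `0` in which each vertex `i` uses only the edge to `c i`. -/
theorem exists_isRefinement₀ (c : I₀ → I₁) (hc : ∀ i, (i, c i) ∈ G.edges) :
    ∃ α : FinDist G.edges, G.IsRefinement₀ α ∧ ∀ f, α.1 f ≠ 0 → f.1.2 = c f.1.1 := by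
  classical
  let x : G.edges → ℝ := fun f => if f.1.2 = c f.1.1 then G.w₀ f.1.1 else 0
  have hx : ∀ i, G.supply x i = G.w₀ i := by
    intro i
    rw [supply, sum_eq_single_of_mem (⟨(i, c i), hc i⟩ : G.edges) (by simp)]
    · simp [x]
    · rintro ⟨⟨i', j⟩, hf⟩ h hne
      obtain rfl : i' = i := (mem_filter.1 h).2
      refine if_neg fun hj => hne ?_
      simp only at hj
      simp [hj]
  have hsum : ∑ f, x f = 1 := by
    have := G.sum_mul_fst x fun _ => 1
    simpa [hx, G.sum_w₀] using this
  refine ⟨⟨x, fun f => ?_, hsum⟩, fun i _ => hx i, fun f hf => ?_⟩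
  · dsimp only [x]
    split_ifs
    exacts [(G.w₀_pos _).le, le_rfl]
  · by_contra h
    exact hf (if_neg h)

theorem exists_isBalanced (hG : G.NoIsolated) : ∃ α : FinDist G.edges, G.IsBalanced α := by
  classical
  choose c hc using hG.1
  obtain ⟨α₀, hα₀, -⟩ := exists_isRefinement₀ c hc
  have hcl : IsClosed {α : FinDist G.edges | G.IsRefinement₀ α} := by
    simp only [IsRefinement₀, Set.ofPred_forall]
    refine isClosed_iInter fun i => isClosed_iInter fun _ => ?_
    exact isClosed_eq (continuous_finsetSum _ fun f _ =>
      (continuous_apply f).comp continuous_subtype_val) continuous_const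
  have : CompactSpace (FinDist G.edges) := isCompact_iff_compactSpace.1 (isCompact_stdSimplex ℝ _)
  have hcont : Continuous fun α : FinDist G.edges => ∑ j, G.load α.1 j ^ 2 / G.w₁ j := by
    refine continuous_finsetSum _ fun j _ => Continuous.div_const (Continuous.pow ?_ 2) _
    exact continuous_finsetSum _ fun f _ => (continuous_apply f).comp continuous_subtype_val
  obtain ⟨α, hα, hmin⟩ := hcl.isCompact.exists_isMinOn ⟨α₀, hα₀⟩ hcont.continuousOn
  exact ⟨α, hα, fun β hβ => hmin hβ⟩

/-- The first-order optimality condition. -/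
theorem IsBalanced.sum_density_le {α β : FinDist G.edges} (hα : G.IsBalanced α)
    (hβ : G.IsRefinement₀ β) :
    ∑ f, G.density α.1 f.1.2 * α.1 f ≤ ∑ f, G.density α.1 f.1.2 * β.1 f := by
  classical
  rw [sum_mul_snd, sum_mul_snd]
  set A : ℝ := ∑ j, G.density α.1 j * (G.load β.1 j - G.load α.1 j) with hA
  set B : ℝ := ∑ j, (G.load β.1 j - G.load α.1 j) ^ 2 / G.w₁ j with hB
  -- Moving from `α` to `β` by a fraction `t` changes the objective by `t * (2 * A + t * B)`.
  have key : ∀ t : ℝ, 0 < t → t ≤ 1 → 0 ≤ 2 * A + t * B := by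
    intro t ht₀ ht₁
    let γ : FinDist G.edges := ⟨(1 - t) • α.1 + t • β.1,
      convex_stdSimplex ℝ _ α.2 β.2 (by linarith) ht₀.le (by ring)⟩
    have hγ : G.IsRefinement₀ γ := by
      intro i hi
      have h₁ := hα.1 i hi
      have h₂ := hβ i hi
      simp only [γ, Pi.add_apply, Pi.smul_apply, smul_eq_mul, sum_add_distrib, ← mul_sum, h₁, h₂]
      ring
    have hload : ∀ j, G.load γ.1 j = G.load α.1 j + t * (G.load β.1 j - G.load α.1 j) := by
      intro j
      simp only [load, γ, Pi.add_apply, Pi.smul_apply, smul_eq_mul, sum_add_distrib, ← mul_sum]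
      ring
    have h := hα.2 γ hγ
    have hexp : ∑ j, G.load γ.1 j ^ 2 / G.w₁ j =
        ∑ j, G.load α.1 j ^ 2 / G.w₁ j + t * (2 * A + t * B) := by
      rw [hA, hB]
      simp only [mul_sum, ← sum_add_distrib]
      refine sum_congr rfl fun j _ => ?_
      rw [hload, density]
      ring
    rw [hexp] at h
    exact nonneg_of_mul_nonneg_right (by linarith) ht₀
  have hB₀ : 0 ≤ B := sum_nonneg fun j _ => div_nonneg (sq_nonneg _) (G.w₁_pos j).le
  have hA₀ : 0 ≤ A := by
    by_contra hneg
    push Not at hneg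
    -- This step length lies in `(0, 1]` and makes `t * B ≤ -A`, so `2 * A + t * B ≤ A < 0`.
    have hpos : 0 < -A / (B - A) := div_pos (by linarith) (by linarith)
    have := key (-A / (B - A)) hpos ((div_le_one (by linarith)).2 (by linarith))
    have h₂ : -A / (B - A) * B ≤ -A := by
      rw [div_mul_eq_mul_div, div_le_iff₀ (by linarith)]
      nlinarith
    linarith
  rw [hA] at hA₀
  simp only [mul_sub, sum_sub_distrib] at hA₀
  linarith

/-- In a balanced refinement, each vertex of side `0` uses only edges to neighbours of least
density. -/
theorem IsBalanced.density_eq (hG : G.NoIsolated) {α : FinDist G.edges} (hα : G.IsBalanced α)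
    {c : I₀ → I₁} (hc : ∀ i, (i, c i) ∈ G.edges)
    (hmin : ∀ i j, (i, j) ∈ G.edges → G.density α.1 (c i) ≤ G.density α.1 j)
    {f : G.edges} (hf : α.1 f ≠ 0) : G.density α.1 f.1.2 = G.density α.1 (c f.1.1) := by
  obtain ⟨β, hβ, hβc⟩ := exists_isRefinement₀ c hc
  have h₁ := hα.sum_density_le hβ
  -- `β` attains the termwise lower bound of `hle`; optimality of `α` then forces equality in every
  -- term.
  have h₂ : ∑ f, G.density α.1 f.1.2 * β.1 f = ∑ f, G.density α.1 (c f.1.1) * α.1 f := by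
    rw [hα.1.sum_mul hG fun i => G.density α.1 (c i),
      ← hβ.sum_mul hG fun i => G.density α.1 (c i)]
    refine sum_congr rfl fun f _ => ?_
    by_cases h : β.1 f = 0
    · simp [h]
    · rw [hβc f h]
  have hle : ∀ f ∈ (univ : Finset G.edges), G.density α.1 (c f.1.1) * α.1 f ≤
      G.density α.1 f.1.2 * α.1 f :=
    fun f _ => mul_le_mul_of_nonneg_right (hmin _ _ f.2) (α.2.1 f)
  have h₃ := (sum_eq_sum_iff_of_le hle).1 (le_antisymm (sum_le_sum hle) (h₁.trans h₂.le)) f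
    (mem_univ f)
  exact (mul_right_cancel₀ hf h₃).symm

theorem exists_min_density (hG : G.NoIsolated) (x : G.edges → ℝ) : ∃ c : I₀ → I₁,
    (∀ i, (i, c i) ∈ G.edges) ∧
      ∀ i j, (i, j) ∈ G.edges → G.density x (c i) ≤ G.density x j := by
  classical
  have : ∀ i, ∃ j, (i, j) ∈ G.edges ∧ ∀ j', (i, j') ∈ G.edges → G.density x j ≤ G.density x j' := by
    intro i
    obtain ⟨j, hj⟩ := hG.1 i
    obtain ⟨j, hj, h⟩ := exists_min_image (univ.filter fun j => (i, j) ∈ G.edges) (G.density x)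
      ⟨j, by simpa using hj⟩
    exact ⟨j, by simpa using hj, fun j' hj' => h j' (by simpa using hj')⟩
  choose c hc using this
  exact ⟨c, fun i => (hc i).1, fun i => (hc i).2⟩

theorem load_nonneg (α : FinDist G.edges) (j : I₁) : 0 ≤ G.load α.1 j :=
  sum_nonneg fun f _ => α.2.1 f

theorem le_load (α : FinDist G.edges) (f : G.edges) : α.1 f ≤ G.load α.1 f.1.2 := by
  classical
  exact single_le_sum (f := α.1) (fun g _ => α.2.1 g) (by simp)

/-- A neighbour `i` of `j` uses some edge, whose right end has positive density. That density is
least among the neighbours of `i`, so the density of `j` is positive too. This permits division by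
the load. -/
theorem IsBalanced.load_pos (hG : G.NoIsolated) {α : FinDist G.edges} (hα : G.IsBalanced α)
    (j : I₁) : 0 < G.load α.1 j := by
  classical
  obtain ⟨c, hc, hmin⟩ := exists_min_density hG α.1
  obtain ⟨i, hi⟩ := hG.2 j
  obtain ⟨f, hf, hfα⟩ : ∃ f ∈ univ.filter (fun f : G.edges => f.1.1 = i), α.1 f ≠ 0 := by
    by_contra! h
    have := hα.1 i ⟨j, hi⟩
    rw [sum_eq_zero (by convert h)] at this
    exact (G.w₀_pos i).ne this
  obtain rfl := (mem_filter.1 hf).2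
  have h₁ : G.density α.1 f.1.2 ≤ G.density α.1 j :=
    (hα.density_eq hG hc hmin hfα).trans_le (hmin _ _ hi)
  have h₂ : 0 < G.density α.1 f.1.2 :=
    div_pos (((α.2.1 f).lt_of_ne' hfα).trans_le (le_load α f)) (G.w₁_pos _)
  exact (div_pos_iff_of_pos_right (G.w₁_pos j)).1 (h₂.trans_le h₁)

/-- The refinement of side `1` in proportion to the amounts received from side `0`. -/
theorem IsBalanced.exists_isUniversallyClosest (hG : G.NoIsolated) {α₀ : FinDist G.edges}
    (hα : G.IsBalanced α₀) : ∃ α₁ : FinDist G.edges,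
      (∀ f, α₁.1 f = α₀.1 f * G.w₁ f.1.2 / G.load α₀.1 f.1.2) ∧
        G.IsUniversallyClosest α₀ α₁ := by
  classical
  have hpos := hα.load_pos hG
  let x : G.edges → ℝ := fun f => α₀.1 f * G.w₁ f.1.2 / G.load α₀.1 f.1.2
  have hload : ∀ j, G.load x j = G.w₁ j := by
    intro j
    have : G.load x j = G.load α₀.1 j * (G.w₁ j / G.load α₀.1 j) := by
      rw [load, load, sum_mul]
      refine sum_congr rfl fun f hf => ?_
      rw [← (mem_filter.1 hf).2]
      simp only [x, load]
      ring
    rw [this, mul_div_cancel₀ _ (hpos j).ne']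
  have hsum : ∑ f, x f = 1 := by
    have := G.sum_mul_snd x fun _ => 1
    simpa [hload, G.sum_w₁] using this
  let α₁ : FinDist G.edges :=
    ⟨x, fun f => div_nonneg (mul_nonneg (α₀.2.1 f) (G.w₁_pos _).le) (hpos _).le, hsum⟩
  have hα₁ : G.IsRefinement₁ α₁ := fun j _ => hload j
  refine ⟨α₁, fun f => rfl, ⟨hα.1, hα₁⟩, fun D hD β₀ β₁ hβ => ?_⟩
  suffices h : ∃ κ, β₀.process κ = α₀ ∧ β₁.process κ = α₁ by
    obtain ⟨κ, h₀, h₁⟩ := h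
    simpa only [h₀, h₁] using hD G.edges G.edges κ β₀ β₁
  refine exists_process_eq _ _ _ _ fun u v => ?_
  obtain ⟨c, hc, hmin⟩ := exists_min_density hG α₀.1
  set ρ := G.density α₀.1 with hρ
  have hρ₀ : ∀ j, 0 ≤ ρ j := fun j => div_nonneg (hpos j).le (G.w₁_pos j).le
  -- The likelihood ratio of an edge is the density of its right end.
  have hα₀₁ : ∀ f, α₀.1 f = ρ f.1.2 * α₁.1 f := by
    intro f
    have h₁ := (hpos f.1.2).ne'
    have h₂ := (G.w₁_pos f.1.2).ne'
    simp only [hρ, density, α₁, x]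
    field_simp
  have hne : Nonempty G.edges := by
    by_contra h
    rw [not_nonempty_iff] at h
    simpa using α₀.2.2
  have hmax : ∀ r : ℝ, ∃ y : G.edges, ∀ z, r * u z + v z ≤ r * u y + v y := fun r =>
    Finite.exists_max fun z => r * u z + v z
  choose y hy using hmax
  -- Exchange argument: adding the two maximality inequalities shows that `u (y r)` grows with `r`;
  -- maximality at `r ≥ 0` then makes `v (y r)` decrease.
  have hanti : ∀ r r', 0 ≤ r → r ≤ r' → v (y r') ≤ v (y r) := by
    intro r r' hr hrr'
    rcases hrr'.eq_or_lt with rfl | hlt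
    · exact le_rfl
    have h₁ := hy r (y r')
    have h₂ := hy r' (y r)
    have h₃ : u (y r) ≤ u (y r') := by
      by_contra! h
      nlinarith
    nlinarith
  refine ⟨fun f => y (ρ (c f.1.1)), ?_⟩
  calc ∑ f, (u f * α₀.1 f + v f * α₁.1 f)
      = ∑ f, (ρ f.1.2 * u f + v f) * α₁.1 f :=
        sum_congr rfl fun f _ => by rw [hα₀₁]; ring
    _ ≤ ∑ f : G.edges, (ρ f.1.2 * u (y (ρ f.1.2)) + v (y (ρ f.1.2))) * α₁.1 f :=
        sum_le_sum fun f _ => mul_le_mul_of_nonneg_right (hy _ _) (α₁.2.1 f)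
    _ = ∑ f : G.edges, u (y (ρ (c f.1.1))) * α₀.1 f + ∑ f : G.edges, v (y (ρ f.1.2)) * α₁.1 f := by
        rw [← sum_add_distrib]
        -- Only the `u`-term carries `α₀`, which lives on least-density edges, so only there may the
        -- right end be traded for the left one.
        refine sum_congr rfl fun f _ => ?_
        rw [add_mul, mul_right_comm, ← hα₀₁, mul_comm (α₀.1 f)]
        by_cases h : α₀.1 f = 0
        · simp [h]
        · rw [show ρ f.1.2 = ρ (c f.1.1) from hα.density_eq hG hc hmin h]
    -- The `u`-sum depends on left ends only and the `v`-sum on right ends only, so both are fixed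
    -- by the vertex weights.
    _ = ∑ f : G.edges, u (y (ρ (c f.1.1))) * β₀.1 f +
          ∑ f : G.edges, v (y (ρ f.1.2)) * β₁.1 f := by
        rw [hα.1.sum_mul hG fun i => u (y (ρ (c i))), hβ.1.sum_mul hG fun i => u (y (ρ (c i))),
          hα₁.sum_mul hG fun j => v (y (ρ j)), hβ.2.sum_mul hG fun j => v (y (ρ j))]
    _ ≤ ∑ f : G.edges, (u (y (ρ (c f.1.1))) * β₀.1 f + v (y (ρ (c f.1.1))) * β₁.1 f) := by
        rw [sum_add_distrib]
        gcongr with f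
        · exact β₁.2.1 f
        · exact hanti _ _ (hρ₀ _) (hmin _ _ f.2)

end DistInstance
end ClosestRefinement

/-! ### Refinements as flows -/

namespace ClosestRefinement

open Finset

namespace DistInstance

variable {n₀ n₁ m : ℕ} (G : DistInstance (Fin n₀) (Fin n₁)) (e : Fin m ≃ G.edges)

/-- The network in which side `0` sends its weights along the edges of the instance to side `1` and
from there to a common sink, the cost being that of the loads of side `1`. -/
noncomputable abbrev flowNetwork : FlowNetwork where
  numV := n₀ + n₁ + 1
  numE := m + n₁
  tail := Fin.append (fun k => ((e k).1.1 : ℕ)) fun j => n₀ + j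
  head := Fin.append (fun k => n₀ + ((e k).1.2 : ℕ)) fun _ => n₀ + n₁
  demand v := if h : (v : ℕ) < n₀ then -G.w₀ ⟨v, h⟩ else if (v : ℕ) = n₀ + n₁ then 1 else 0
  cap _ := 1
  quad := Fin.append (fun _ => 0) fun j => 1 / G.w₁ j

theorem supply_eq_sum (x : G.edges → ℝ) (i : Fin n₀) :
    G.supply x i = ∑ k, if ((e k).1.1 : ℕ) = i then x (e k) else 0 := by
  rw [supply, sum_filter, ← e.sum_comp]
  exact sum_congr rfl fun k _ => by simp only [Fin.ext_iff]

theorem load_eq_sum (x : G.edges → ℝ) (j : Fin n₁) :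
    G.load x j = ∑ k, if ((e k).1.2 : ℕ) = j then x (e k) else 0 := by
  rw [load, sum_filter, ← e.sum_comp]
  exact sum_congr rfl fun k _ => by simp only [Fin.ext_iff]

theorem flowNetwork_inflow (f : Fin (m + n₁) → ℝ) (v : ℕ) :
    ∑ a with (G.flowNetwork e).head a = v, f a =
      (∑ k, if n₀ + ((e k).1.2 : ℕ) = v then f (Fin.castAdd n₁ k) else 0) +
        ∑ j, if n₀ + n₁ = v then f (Fin.natAdd m j) else 0 := by
  rw [sum_filter]
  refine (Fin.sum_univ_add _).trans ?_
  simp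

theorem flowNetwork_outflow (f : Fin (m + n₁) → ℝ) (v : ℕ) :
    ∑ a with (G.flowNetwork e).tail a = v, f a =
      (∑ k, if ((e k).1.1 : ℕ) = v then f (Fin.castAdd n₁ k) else 0) +
        ∑ j : Fin n₁, if n₀ + (j : ℕ) = v then f (Fin.natAdd m j) else 0 := by
  rw [sum_filter]
  refine (Fin.sum_univ_add _).trans ?_
  simp

theorem flowNetwork_cost (f : Fin (m + n₁) → ℝ) :
    (G.flowNetwork e).cost f = ∑ j, f (Fin.natAdd m j) ^ 2 / G.w₁ j := by
  refine (Fin.sum_univ_add _).trans ?_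
  simp [div_eq_inv_mul]

variable {G}

theorem sum_load (α : FinDist G.edges) : ∑ j, G.load α.1 j = 1 := by
  have := G.sum_mul_snd α.1 fun _ => 1
  simp only [one_mul] at this
  rw [← this]
  exact α.2.2

/-- The unit capacities exclude nothing, since the total mass is `1`. -/
theorem IsRefinement₀.isFlow (hG : G.NoIsolated) {α : FinDist G.edges} (hα : G.IsRefinement₀ α) :
    (G.flowNetwork e).IsFlow (Fin.append (fun k => α.1 (e k)) (G.load α.1)) := by
  have hle : ∀ j, G.load α.1 j ≤ 1 := fun j =>
    (single_le_sum (fun j _ => load_nonneg α j) (mem_univ j)).trans_eq (sum_load α)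
  refine ⟨fun a => ?_, fun v => ?_⟩
  · refine Fin.addCases (m := m) (n := n₁) (fun k => ?_) (fun j => ?_) a
    · rw [Fin.append_left]
      exact ⟨α.2.1 _, (le_load α _).trans (hle _)⟩
    · rw [Fin.append_right]
      exact ⟨load_nonneg α j, hle j⟩
  · have hv : (v : ℕ) < n₀ + n₁ + 1 := v.2
    refine (congrArg₂ _ (G.flowNetwork_inflow e _ v) (G.flowNetwork_outflow e _ v)).trans ?_
    simp only [Fin.append_left, Fin.append_right]
    rcases lt_or_ge (v : ℕ) n₀ with h | h
    · have h₁ : ∀ k : ℕ, ¬ n₀ + k = v := fun k => by omega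
      simp only [h₁, if_false, sum_const_zero, h, dif_pos]
      rw [← show G.supply α.1 ⟨v, h⟩ = _ from hα ⟨v, h⟩ (hG.1 _), G.supply_eq_sum e]
      simp
    · obtain ⟨j, hj⟩ := Nat.exists_eq_add_of_le h
      have h₁ : ∀ k, ¬ ((e k).1.1 : ℕ) = n₀ + j := fun k => by omega
      simp only [h₁, if_false, sum_const_zero, hj, add_right_inj]
      -- For `j < n₁` a right vertex forwards its load; `j = n₁` is the sink, which collects the
      -- total mass `1`.
      rcases (show j ≤ n₁ by omega).lt_or_eq with h₂ | rfl
      · rw [← G.load_eq_sum e α.1 ⟨j, h₂⟩]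
        have : ∀ i : Fin n₁, (i : ℕ) = j ↔ i = ⟨j, h₂⟩ := fun i => by simp [Fin.ext_iff]
        simp [h₂.ne, h₂.ne', this]
      · have h₃ : ∀ i : Fin j, ¬ (i : ℕ) = j := fun i => i.2.ne
        simp [h₃, sum_load]

/-- Conservation at the left vertices gives the refinement property; at the right vertices it
identifies the flow to the sink with the load. -/
theorem isRefinement₀_of_isFlow {f : Fin (m + n₁) → ℝ}
    (hf : (G.flowNetwork e).IsFlow f) : ∃ α : FinDist G.edges, G.IsRefinement₀ α ∧
      (∀ k, α.1 (e k) = f (Fin.castAdd n₁ k)) ∧ ∀ j, G.load α.1 j = f (Fin.natAdd m j) := by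
  classical
  let x : G.edges → ℝ := fun g => f (Fin.castAdd n₁ (e.symm g))
  have hx : ∀ k, x (e k) = f (Fin.castAdd n₁ k) := fun k => by simp [x]
  have h₀ : ∀ i, G.supply x i = G.w₀ i := by
    intro i
    have h := hf.2 ⟨i, by have := i.2; change _ < n₀ + n₁ + 1; omega⟩
    have h := (congrArg₂ _ (G.flowNetwork_inflow e f i) (G.flowNetwork_outflow e f i)).symm.trans h
    have h₁ : ∀ k : ℕ, ¬ n₀ + k = i := fun k => by omega
    simp only [h₁, if_false, sum_const_zero, i.2, dif_pos] at h
    rw [G.supply_eq_sum e]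
    simpa [hx] using h
  have h₁ : ∀ j, G.load x j = f (Fin.natAdd m j) := by
    intro j
    have h := hf.2 ⟨n₀ + j, by have := j.2; change _ < n₀ + n₁ + 1; omega⟩
    have h := (congrArg₂ _ (G.flowNetwork_inflow e f (n₀ + j))
      (G.flowNetwork_outflow e f (n₀ + j))).symm.trans h
    have h₁ : ∀ k, ¬ ((e k).1.1 : ℕ) = n₀ + j := fun k => by omega
    rw [G.load_eq_sum e]
    have h₃ : ∀ i : Fin n₁, (i : ℕ) = j ↔ i = j := fun i => Fin.ext_iff.symm
    simp [hx, h₁, j.2.ne, j.2.ne', h₃] at h ⊢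
    linarith
  have hsum : ∑ g, x g = 1 := by
    have := G.sum_mul_fst x fun _ => 1
    simpa [h₀, G.sum_w₀] using this
  exact ⟨⟨x, fun g => (hf.1 _).1, hsum⟩, fun i _ => h₀ i, hx, h₁⟩

theorem isBalanced_of_isOptimal (hG : G.NoIsolated) {f : Fin (m + n₁) → ℝ}
    (hf : (G.flowNetwork e).IsOptimal f) : ∃ α : FinDist G.edges, G.IsBalanced α ∧
      (∀ k, α.1 (e k) = f (Fin.castAdd n₁ k)) ∧ ∀ j, G.load α.1 j = f (Fin.natAdd m j) := by
  obtain ⟨α, hα, h₁, h₂⟩ := isRefinement₀_of_isFlow e hf.1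
  refine ⟨α, ⟨hα, fun β hβ => ?_⟩, h₁, h₂⟩
  have h := hf.2 _ (hβ.isFlow e hG)
  rw [flowNetwork_cost, flowNetwork_cost] at h
  simpa only [h₂, Fin.append_right] using h

theorem flowNetwork_isProper (hG : G.NoIsolated) : (G.flowNetwork e).IsProper := by
  refine ⟨?_, fun _ => zero_le_one, ?_, ?_⟩
  · refine Fin.addCases (m := m) (n := n₁) (fun k => ?_) (fun j => ?_)
    · simp only [Fin.append_left]
      omega
    · simp only [Fin.append_right]
      omega
  · refine Fin.addCases (m := m) (n := n₁) (fun k => ?_) (fun j => ?_)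
    · simp
    · simp [(G.w₁_pos j).le]
  · choose c hc using hG.1
    obtain ⟨α, hα, -⟩ := exists_isRefinement₀ c hc
    exact ⟨_, hα.isFlow e hG⟩

/-- Choosing an incident edge for each vertex is injective. This makes bounds in the numbers of
vertices linear in `m`. -/
theorem card_fst_le (e : Fin m ≃ G.edges) (hG : G.NoIsolated) : n₀ ≤ m := by
  choose c hc using hG.1
  simpa using Fintype.card_le_of_injective (fun i => e.symm ⟨(i, c i), hc i⟩) fun i i' h => by
    simpa using congrArg (fun g : G.edges => g.1.1) (e.symm.injective h)

theorem card_snd_le (e : Fin m ≃ G.edges) (hG : G.NoIsolated) : n₁ ≤ m := by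
  choose c hc using hG.2
  simpa using Fintype.card_le_of_injective (fun j => e.symm ⟨(c j, j), hc j⟩) fun j j' h => by
    simpa using congrArg (fun g : G.edges => g.1.2) (e.symm.injective h)

theorem one_le_card (e : Fin m ≃ G.edges) (hG : G.NoIsolated) : 1 ≤ m := by
  refine le_trans (Nat.one_le_iff_ne_zero.2 ?_) (card_fst_le e hG)
  rintro rfl
  simpa using G.sum_w₀

end DistInstance

/-! ### Near-linear time bounds -/

theorem NearLinear.exists_bound {T : ℕ → ℕ} (hT : NearLinear T) (C : ℕ) :
    ∃ T' : ℕ → ℕ, NearLinear T' ∧ ∀ m s, s ≤ C * m → C * m + T s ≤ T' m := by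
  -- `T` need not be monotone, hence the supremum over all sizes up to `C * m`.
  refine ⟨fun m => C * m + (range (C * m + 1)).sup T, fun ε hε => ?_, fun m s hs =>
    Nat.add_le_add_left (le_sup (f := T) (mem_range.2 (by omega))) _⟩
  obtain ⟨K, hK₀, hK⟩ := (hT ε hε).exists_pos
  rw [Asymptotics.isBigOWith_iff, Filter.eventually_atTop] at hK
  obtain ⟨n, hn⟩ := hK
  -- `B` covers the finitely many sizes below the threshold of the asymptotic bound.
  set B : ℕ := (range n).sup T with hB
  have hbound : ∀ m s : ℕ, s ≤ C * m → (T s : ℝ) ≤ B + K * ((C * m : ℕ) : ℝ) ^ (1 + ε) := by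
    intro m s hs
    have h₀ : 0 ≤ K * ((C * m : ℕ) : ℝ) ^ (1 + ε) := by positivity
    rcases lt_or_ge s n with h | h
    · have : T s ≤ B := le_sup (f := T) (mem_range.2 h)
      have : (T s : ℝ) ≤ B := by exact_mod_cast this
      linarith
    · have h₁ := hn s h
      rw [Real.norm_of_nonneg (by positivity), Real.norm_of_nonneg (by positivity)] at h₁
      have h₂ : (s : ℝ) ^ (1 + ε) ≤ ((C * m : ℕ) : ℝ) ^ (1 + ε) :=
        Real.rpow_le_rpow (by positivity) (by exact_mod_cast hs) (by linarith)
      have : (0 : ℝ) ≤ B := by positivity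
      nlinarith
  refine Asymptotics.IsBigO.of_bound (C + B + K * (C : ℝ) ^ (1 + ε)) ?_
  filter_upwards [Filter.eventually_ge_atTop 1] with m hm
  have hm' : (1 : ℝ) ≤ m := by exact_mod_cast hm
  rw [Real.norm_of_nonneg (by positivity), Real.norm_of_nonneg (by positivity)]
  obtain ⟨s, hs, hsup⟩ := exists_mem_eq_sup (range (C * m + 1)) ⟨0, by simp⟩ T
  have h₁ := hbound m s (by have := mem_range.1 hs; omega)
  have h₂ : (m : ℝ) ≤ (m : ℝ) ^ (1 + ε) := by
    simpa using Real.rpow_le_rpow_of_exponent_le hm' (by linarith : (1 : ℝ) ≤ 1 + ε)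
  have h₃ : (1 : ℝ) ≤ (m : ℝ) ^ (1 + ε) := hm'.trans h₂
  push_cast [hsup] at h₁ ⊢
  rw [Real.mul_rpow (by positivity) (by positivity)] at h₁
  have h₄ : (C : ℝ) * m ≤ C * (m : ℝ) ^ (1 + ε) := by gcongr
  have h₅ : (B : ℝ) * 1 ≤ B * (m : ℝ) ^ (1 + ε) := by gcongr
  linarith

end ClosestRefinement

/-! ### The program and its loops -/

namespace ClosestRefinement

namespace Program

local infixr:60 " ;; " => Program.seq

/-- Enter the demand of a vertex of side `0`. -/
def demandBody : Program :=
  rload 0 4 7 ;; rop .sub 0 2 0 ;; rstore 0 7 0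

/-- Enter the network edge for an edge of the instance. -/
def edgeBody : Program :=
  iload 8 2 7 ;; istore 0 7 8 ;; iload 8 3 7 ;; iadd 8 2 8 ;; istore 1 7 8 ;; rstore 1 7 1

/-- Enter the network edge from a vertex of side `1` to the sink. -/
def sinkBody : Program :=
  iadd 8 4 7 ;; iadd 9 2 7 ;; istore 0 8 9 ;; istore 1 8 5 ;; rstore 1 8 1 ;; rload 0 5 7 ;;
    rop .div 0 1 0 ;; rstore 2 8 0

/-- Compute the two refinements on an edge of the instance. -/
def outputBody : Program :=
  rload 3 3 7 ;; rstore 6 7 3 ;; iload 8 3 7 ;; iadd 9 4 8 ;; rload 4 3 9 ;; rload 5 5 8 ;;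
    rop .mul 3 3 5 ;; rop .div 3 3 4 ;; rstore 7 7 3

/-- Enter the sizes of the network and the demand of the sink. -/
def header : Program :=
  iadd 5 2 3 ;; iconst 6 1 ;; iadd 0 5 6 ;; iadd 1 4 3 ;; rconst 1 1 ;; rstore 0 5 1

/-- Compute a universally closest refinement pair by a call of the flow solver. -/
def closestPair : Program :=
  header ;; loop 7 2 demandBody ;; loop 7 4 edgeBody ;; loop 7 3 sinkBody ;; solve ;;
    loop 7 4 outputBody

/-- The number of iterations is read once, before the body runs. The invariant is met after the step
charged for the loop itself, and each iteration is charged one step before its body. -/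
theorem exec_loop_induction (S : FlowSolver) (x b : ℕ) (p : Program) (r : Run)
    (Inv : ℕ → Run → Prop) (h₀ : Inv 0 (r.step r.mem))
    (hs : ∀ k < r.mem.ireg b, ∀ r', Inv k r' →
      Inv (k + 1) (p.exec S (r'.step { r'.mem with ireg := Function.update r'.mem.ireg x k }))) :
    Inv (r.mem.ireg b) ((loop x b p).exec S r) := by
  rw [Program.exec]
  generalize r.mem.ireg b = n at hs ⊢
  induction n with
  | zero => exact h₀
  | succ n ih =>
    rw [List.range_succ, List.foldl_append]
    exact hs n n.lt_succ_self _ (ih fun k hk => hs k (by omega))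

end Program

/-! ### Invariants before and after the solver call -/

/-- The run `r`, with input memory `s`, has entered the header of the network, the first `a` demands
of side `0`, the first `b` edges of the instance and the first `c` edges to the sink. -/
structure Building (s : Memory) (a b c t : ℕ) (r : Run) : Prop where
  steps : r.steps = t
  queries : r.queries = []
  ireg₀ : r.mem.ireg 0 = s.ireg 2 + s.ireg 3 + 1
  ireg₁ : r.mem.ireg 1 = s.ireg 4 + s.ireg 3
  ireg₂ : r.mem.ireg 2 = s.ireg 2
  ireg₃ : r.mem.ireg 3 = s.ireg 3
  ireg₄ : r.mem.ireg 4 = s.ireg 4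
  ireg₅ : r.mem.ireg 5 = s.ireg 2 + s.ireg 3
  rreg₁ : r.mem.rreg 1 = 1
  rreg₂ : r.mem.rreg 2 = 0
  iarr₂ : r.mem.iarr 2 = s.iarr 2
  iarr₃ : r.mem.iarr 3 = s.iarr 3
  rarr₄ : r.mem.rarr 4 = s.rarr 4
  rarr₅ : r.mem.rarr 5 = s.rarr 5
  demand : ∀ v, r.mem.rarr 0 v =
    if v < a then -s.rarr 4 v else if v = s.ireg 2 + s.ireg 3 then 1 else 0
  tail : ∀ k, r.mem.iarr 0 k = if k < b then s.iarr 2 k else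
    if s.ireg 4 ≤ k ∧ k < s.ireg 4 + c then s.ireg 2 + (k - s.ireg 4) else 0
  head : ∀ k, r.mem.iarr 1 k = if k < b then s.ireg 2 + s.iarr 3 k else
    if s.ireg 4 ≤ k ∧ k < s.ireg 4 + c then s.ireg 2 + s.ireg 3 else 0
  cap : ∀ k, r.mem.rarr 1 k = if k < b then 1 else
    if s.ireg 4 ≤ k ∧ k < s.ireg 4 + c then 1 else 0
  quad : ∀ k, r.mem.rarr 2 k =
    if s.ireg 4 ≤ k ∧ k < s.ireg 4 + c then 1 / s.rarr 5 (k - s.ireg 4) else 0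

namespace Building

variable {s : Memory} {a b c t : ℕ} {r : Run} {S : FlowSolver}

/-- The zeros of the input memory matter: real register `2` serves as the `0` in negating weights,
and unwritten cells supply the zero demands of side `1` and the zero costs of the instance edges. -/
theorem init (hr : ∀ x, s.rreg x = 0)
    (hia : ∀ k x, k < 2 → s.iarr k x = 0) (hra : ∀ k x, k < 3 → s.rarr k x = 0) :
    Building s 0 0 0 6 (Program.header.exec S ⟨s, 0, []⟩) := by
  constructor <;>
    simp [Program.header, Program.exec, Run.step, Function.update_apply, hr, hia, hra]

theorem step (h : Building s a b c t r) : Building s a b c (t + 1) (r.step r.mem) := by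
  cases h
  constructor <;> simp_all [Run.step]

theorem demandBody (h : Building s a b c t r) (ha : a < s.ireg 2) :
    Building s (a + 1) b c (t + 4) (Program.demandBody.exec S
      (r.step { r.mem with ireg := Function.update r.mem.ireg 7 a })) := by
  constructor <;>
    simp [Program.demandBody, Program.exec, Run.step, Function.update_apply, RealOp.eval, h.steps,
      h.queries, h.ireg₀, h.ireg₁, h.ireg₂, h.ireg₃, h.ireg₄, h.ireg₅, h.rreg₁, h.rreg₂, h.iarr₂,
      h.iarr₃, h.rarr₄, h.rarr₅, h.demand, h.tail, h.head, h.cap, h.quad]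
  intro v
  rcases lt_trichotomy v a with hv | rfl | hv
  · simp [hv.ne, hv, hv.le]
  · simp
  · simp [hv.ne', hv.not_gt, hv.not_ge]

theorem edgeBody (h : Building s a b c t r) (hb : b < s.ireg 4) :
    Building s a (b + 1) c (t + 7) (Program.edgeBody.exec S
      (r.step { r.mem with ireg := Function.update r.mem.ireg 7 b })) := by
  constructor <;>
    simp [Program.edgeBody, Program.exec, Run.step, Function.update_apply, h.steps,
      h.queries, h.ireg₀, h.ireg₁, h.ireg₂, h.ireg₃, h.ireg₄, h.ireg₅, h.rreg₁, h.rreg₂, h.iarr₂,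
      h.iarr₃, h.rarr₄, h.rarr₅, h.demand, h.tail, h.head, h.cap, h.quad]
  all_goals
    intro v
    rcases lt_trichotomy v b with hv | rfl | hv
    · simp [hv.ne, hv, hv.le]
    · simp
    · simp [hv.ne', hv.not_gt, hv.not_ge]

/-- Sink edges occupy the cells from `s.ireg 4` on, so `hb` keeps them apart from the instance
edges. Of the nine steps, eight are instructions and one is the iteration. -/
theorem sinkBody (h : Building s a b c t r) (hb : b ≤ s.ireg 4) :
    Building s a b (c + 1) (t + 9) (Program.sinkBody.exec S
      (r.step { r.mem with ireg := Function.update r.mem.ireg 7 c })) := by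
  constructor <;>
    simp [Program.sinkBody, Program.exec, Run.step, Function.update_apply, RealOp.eval, h.steps,
      h.queries, h.ireg₀, h.ireg₁, h.ireg₂, h.ireg₃, h.ireg₄, h.ireg₅, h.rreg₁, h.rreg₂, h.iarr₂,
      h.iarr₃, h.rarr₄, h.rarr₅, h.demand, h.tail, h.head, h.cap, h.quad]
  all_goals
    intro v
    rcases lt_trichotomy v (s.ireg 4 + c) with hv | rfl | hv
    · simp [hv.ne, hv, show v < s.ireg 4 + (c + 1) by omega]
    · simp [show ¬ s.ireg 4 + c < b by omega]
    · simp [hv.ne', hv.not_gt, show ¬ v < s.ireg 4 + (c + 1) by omega]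

theorem loop_demandBody (h : Building s 0 b c t r) :
    Building s (s.ireg 2) b c (t + 1 + 4 * s.ireg 2)
      ((Program.loop 7 2 Program.demandBody).exec S r) := by
  have := Program.exec_loop_induction S 7 2 Program.demandBody r
    (fun k => Building s k b c (t + 1 + 4 * k)) h.step fun k hk r' h' => by
      have := h'.demandBody (S := S) (h.ireg₂ ▸ hk)
      rwa [add_assoc] at this
  rwa [h.ireg₂] at this

theorem loop_edgeBody (h : Building s a 0 c t r) :
    Building s a (s.ireg 4) c (t + 1 + 7 * s.ireg 4)
      ((Program.loop 7 4 Program.edgeBody).exec S r) := by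
  have := Program.exec_loop_induction S 7 4 Program.edgeBody r
    (fun k => Building s a k c (t + 1 + 7 * k)) h.step fun k hk r' h' => by
      have := h'.edgeBody (S := S) (h.ireg₄ ▸ hk)
      rwa [add_assoc] at this
  rwa [h.ireg₄] at this

theorem loop_sinkBody (h : Building s a b 0 t r) (hb : b ≤ s.ireg 4) :
    Building s a b (s.ireg 3) (t + 1 + 9 * s.ireg 3)
      ((Program.loop 7 3 Program.sinkBody).exec S r) := by
  have := Program.exec_loop_induction S 7 3 Program.sinkBody r
    (fun k => Building s a b k (t + 1 + 9 * k)) h.step fun k hk r' h' => by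
      have := h'.sinkBody (S := S) hb
      rwa [add_assoc] at this
  rwa [h.ireg₃] at this

end Building

/-- The run `r`, with input memory `s`, has called the solver for the network `N` with the answer
`ans` and has computed the refinements on the first `k` edges. -/
structure Finishing (s : Memory) (N : FlowNetwork) (ans : ℕ → ℝ) (k t : ℕ) (r : Run) : Prop where
  steps : r.steps = t
  queries : r.queries = [N]
  ireg₄ : r.mem.ireg 4 = s.ireg 4
  iarr₃ : r.mem.iarr 3 = s.iarr 3
  rarr₃ : r.mem.rarr 3 = ans
  rarr₅ : r.mem.rarr 5 = s.rarr 5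
  rarr₆ : ∀ l < k, r.mem.rarr 6 l = ans l
  rarr₇ : ∀ l < k, r.mem.rarr 7 l =
    ans l * s.rarr 5 (s.iarr 3 l) / ans (s.ireg 4 + s.iarr 3 l)

namespace Finishing

variable {s : Memory} {N : FlowNetwork} {ans : ℕ → ℝ} {k t : ℕ} {r : Run} {S : FlowSolver}

theorem step (h : Finishing s N ans k t r) : Finishing s N ans k (t + 1) (r.step r.mem) := by
  cases h
  constructor <;> simp_all [Run.step]

theorem outputBody (h : Finishing s N ans k t r) :
    Finishing s N ans (k + 1) (t + 10) (Program.outputBody.exec S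
      (r.step { r.mem with ireg := Function.update r.mem.ireg 7 k })) := by
  constructor <;>
    simp [Program.outputBody, Program.exec, Run.step, Function.update_apply, RealOp.eval, h.steps,
      h.queries, h.ireg₄, h.iarr₃, h.rarr₃, h.rarr₅]
  all_goals
    intro l hl
    rcases hl.eq_or_lt with rfl | hl
    · simp
    · simp [hl.ne, h.rarr₆ l hl, h.rarr₇ l hl]

theorem loop_outputBody (h : Finishing s N ans 0 t r) :
    Finishing s N ans (s.ireg 4) (t + 1 + 10 * s.ireg 4)
      ((Program.loop 7 4 Program.outputBody).exec S r) := by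
  have := Program.exec_loop_induction S 7 4 Program.outputBody r
    (fun k => Finishing s N ans k (t + 1 + 10 * k)) h.step fun k _ r' h' => by
      have := h'.outputBody (S := S)
      rwa [add_assoc] at this
  rwa [h.ireg₄] at this

end Finishing

/-- The sizes in memory equal the intended ones only propositionally, so the fields are compared
along `Fin.cast`. -/
theorem FlowNetwork.ext_of_forall {V E V' E' : ℕ} {t h : Fin E → ℕ} {d : Fin V → ℝ}
    {u a : Fin E → ℝ} {t' h' : Fin E' → ℕ} {d' : Fin V' → ℝ} {u' a' : Fin E' → ℝ}
    (hV : V = V') (hE : E = E')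
    (hd : ∀ v, d v = d' (Fin.cast hV v))
    (hedge : ∀ k, t k = t' (Fin.cast hE k) ∧ h k = h' (Fin.cast hE k) ∧
      u k = u' (Fin.cast hE k) ∧ a k = a' (Fin.cast hE k)) :
    FlowNetwork.mk V E t h d u a = ⟨V', E', t', h', d', u', a'⟩ := by
  subst hV hE
  obtain rfl : d = d' := funext hd
  obtain rfl : t = t' := funext fun k => (hedge k).1
  obtain rfl : h = h' := funext fun k => (hedge k).2.1
  obtain rfl : u = u' := funext fun k => (hedge k).2.2.1
  obtain rfl : a = a' := funext fun k => (hedge k).2.2.2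
  rfl

/-! ### Correctness and running time on encoded instances -/

variable {n₀ n₁ m : ℕ} {G : DistInstance (Fin n₀) (Fin n₁)} {e : Fin m ≃ G.edges}

theorem Building.network_eq {t : ℕ} {r : Run} (h : Building (G.encode e) n₀ m n₁ t r) :
    r.mem.network = G.flowNetwork e := by
  have hE : r.mem.ireg 1 = m + n₁ := h.ireg₁
  have hV : r.mem.ireg 0 = n₀ + n₁ + 1 := h.ireg₀
  refine FlowNetwork.ext_of_forall hV hE (fun v => ?_) fun k => ?_
  · rw [h.demand]
    by_cases hv : (v : ℕ) < n₀ <;> simp [DistInstance.encode, hv]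
  · rw [h.tail, h.head, h.cap, h.quad]
    obtain ⟨k, rfl⟩ : ∃ k', k = Fin.cast hE.symm k' := ⟨Fin.cast hE k, rfl⟩
    refine Fin.addCases (m := m) (n := n₁) (fun k => ?_) (fun j => ?_) k
    · have : ¬ m ≤ k := by omega
      simp [DistInstance.encode, this]
    · simp [DistInstance.encode]

theorem Program.exec_solve_rarr (S : FlowSolver) (r : Run) {N : FlowNetwork}
    (hN : r.mem.network = N) (k : Fin N.numE) :
    (Program.solve.exec S r).mem.rarr 3 k = S N k := by
  subst hN
  simp [Program.exec]

theorem Building.solve {S : FlowSolver} {t : ℕ} {r : Run}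
    (h : Building (G.encode e) n₀ m n₁ t r) :
    Finishing (G.encode e) (G.flowNetwork e) ((Program.solve.exec S r).mem.rarr 3) 0 (t + 1)
      (Program.solve.exec S r) := by
  constructor <;> simp [Program.exec, h.network_eq, h.steps, h.queries, h.ireg₄, h.iarr₃, h.rarr₅]

theorem Program.closestPair_run (S : FlowSolver) (G : DistInstance (Fin n₀) (Fin n₁))
    (e : Fin m ≃ G.edges) :
    ∃ ans : ℕ → ℝ, (∀ k : Fin (m + n₁), ans k = S (G.flowNetwork e) k) ∧
      Finishing (G.encode e) (G.flowNetwork e) ans m (11 + 4 * n₀ + 17 * m + 9 * n₁)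
        (Program.closestPair.run S G e) := by
  have h : Building (G.encode e) n₀ m n₁ _ _ :=
    ((Building.init (S := S) (s := G.encode e) (fun _ => rfl) (fun k x hk => ?_)
      fun k x hk => ?_).loop_demandBody (S := S)).loop_edgeBody (S := S)
      |>.loop_sinkBody (S := S) le_rfl
  · refine ⟨_, fun k => Program.exec_solve_rarr S _ h.network_eq k, ?_⟩
    -- The header takes `6` steps and the call `1`; each of the four loops adds `1` to the cost of
    -- its iterations.
    rw [show 11 + 4 * n₀ + 17 * m + 9 * n₁ =
      6 + 1 + 4 * n₀ + 1 + 7 * m + 1 + 9 * n₁ + 1 + 1 + 10 * m by ring]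
    exact (h.solve (S := S)).loop_outputBody (S := S)
  · interval_cases k <;> rfl
  · interval_cases k <;> rfl

variable (e) in
theorem Program.closestPair_steps_le (S : FlowSolver) (hG : G.NoIsolated) :
    (Program.closestPair.run S G e).steps ≤ 41 * m := by
  obtain ⟨ans, -, h⟩ := Program.closestPair_run S G e
  have h₀ := DistInstance.card_fst_le e hG
  have h₁ := DistInstance.card_snd_le e hG
  have h₂ := DistInstance.one_le_card e hG
  rw [h.steps]
  -- `41 = 11 + 4 + 17 + 9`, using `n₀, n₁ ≤ m` and `1 ≤ m`.
  omega

variable (e) in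
theorem DistInstance.flowNetwork_size_le (hG : G.NoIsolated) :
    (G.flowNetwork e).size ≤ 41 * m := by
  have h₀ := DistInstance.card_fst_le e hG
  have h₁ := DistInstance.card_snd_le e hG
  have h₂ := DistInstance.one_le_card e hG
  simp only [FlowNetwork.size]
  omega

variable (e) in
theorem Program.closestPair_returns {S : FlowSolver} (hG : G.NoIsolated)
    (hS : (G.flowNetwork e).IsOptimal (S (G.flowNetwork e))) :
    ∃ α₀ α₁ : FinDist G.edges,
      (Program.closestPair.run S G e).Returns e α₀ α₁ ∧ G.IsUniversallyClosest α₀ α₁ := by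
  obtain ⟨ans, hans, h⟩ := Program.closestPair_run S G e
  obtain ⟨α₀, hα₀, hedge, hload⟩ := DistInstance.isBalanced_of_isOptimal e hG hS
  obtain ⟨α₁, hα₁, hclosest⟩ := hα₀.exists_isUniversallyClosest hG
  refine ⟨α₀, α₁, fun k => ?_, hclosest⟩
  have h₀ : ans k = α₀.1 (e k) := by
    rw [hedge, ← hans]
    rfl
  -- The denominator used by the program is the flow on the sink edge of the right end, that is, its
  -- load.
  have h₁ : ans (m + (e k).1.2) = G.load α₀.1 (e k).1.2 := by
    rw [hload, ← hans]
    rfl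
  refine ⟨(h.rarr₆ k k.2).trans h₀, (h.rarr₇ k k.2).trans ?_⟩
  rw [hα₁, ← h₀, ← h₁]
  simp [DistInstance.encode]

end ClosestRefinement

theorem theorem1 :
    -- existence of a universally closest refinement pair
    (∀ (I₀ I₁ : Type u) [Fintype I₀] [Fintype I₁] (G : DistInstance I₀ I₁), G.NoIsolated →
      ∃ α₀ α₁ : FinDist G.edges, G.IsUniversallyClosest α₀ α₁) ∧
    -- its computation by means of a solver for minimum quadratic-cost flow
    ∃ p : Program,
      (∃ C : ℕ, ∀ (S : FlowSolver) (n₀ n₁ m : ℕ) (G : DistInstance (Fin n₀) (Fin n₁))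
        (e : Fin m ≃ G.edges), G.NoIsolated →
          (p.run S G e).steps ≤ C * m ∧
          ∃ N : FlowNetwork, (p.run S G e).queries = [N] ∧ N.IsProper ∧ N.size ≤ C * m ∧
            (N.IsOptimal (S N) → ∃ α₀ α₁ : FinDist G.edges,
              (p.run S G e).Returns e α₀ α₁ ∧ G.IsUniversallyClosest α₀ α₁)) ∧
      (∀ T : ℕ → ℕ, NearLinear T → ∃ T' : ℕ → ℕ, NearLinear T' ∧
        ∀ (S : FlowSolver) (n₀ n₁ m : ℕ) (G : DistInstance (Fin n₀) (Fin n₁))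
          (e : Fin m ≃ G.edges), G.NoIsolated → (p.run S G e).time T ≤ T' m) := by
  refine ⟨fun I₀ I₁ _ _ G hG => ?_, Program.closestPair, ⟨41, fun S n₀ n₁ m G e hG => ?_⟩,
    fun T hT => ?_⟩
  · obtain ⟨α₀, hα₀⟩ := DistInstance.exists_isBalanced hG
    obtain ⟨α₁, -, h⟩ := hα₀.exists_isUniversallyClosest hG
    exact ⟨α₀, α₁, h⟩
  · obtain ⟨ans, -, h⟩ := Program.closestPair_run S G e
    exact ⟨Program.closestPair_steps_le e S hG, _, h.queries, G.flowNetwork_isProper e hG,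
      DistInstance.flowNetwork_size_le e hG, Program.closestPair_returns e hG⟩
  · obtain ⟨T', hT', hle⟩ := hT.exists_bound 41
    refine ⟨T', hT', fun S n₀ n₁ m G e hG => ?_⟩
    obtain ⟨ans, -, h⟩ := Program.closestPair_run S G e
    refine le_trans ?_ (hle m _ (DistInstance.flowNetwork_size_le e hG))
    simpa [Run.time, h.queries] using Program.closestPair_steps_le e S hG
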